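/- For $p\in\mathbb N$ and $q\in\mathbb N\cup\{\infty\}$, colour the vertices of a set $S$ of vertices of a finite simple graph $G$ blue and all other vertices white. The $(p,q)$-spreading rule recolours a white vertex $w$ blue if $w$ has at least $p$ blue neighbours and at least one of these blue neighbours has at most $q$ white neighbours; the $r$-percolation rule recolours a white vertex blue if it has at least $r$ blue neighbours. The set $S$ is a $(p,q)$-spreading set (respectively, an $r$-percolating set) of $G$ if repeated application of the respective rule eventually colours all vertices blue, and $\sigma_{(p,q)}(G)$ denotes the minimum cardinality of a $(p,q)$-spreading set of $G$. A diamond is the graph $K_4-e$, that is, $K_4$ with one edge removed. For $k\ge 2$, the diamond-necklace $N_k$ is obtained from $k$ disjoint diamonds with vertex sets $\{a_i,b_i,c_i,d_i\}$, $1\le i\le k$, where $a_ib_i$ is the missing edge, by adding the edges $a_ib_{i+1}$ for $1\le i\le k-1$ and the edge $a_kb_1$. Let $G$ be a finite cubic graph. Then a set $S\subseteq V(G)$ is a $(2,3)$-spreading set of $G$ if and only if it is a $2$-percolating set of $G$. Moreover, if $G$ is connected, claw-free (it has no induced $K_{1,3}$) and not isomorphic to $K_4$, then $V(G)$ has a unique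 partition into sets each of which induces a triangle or a diamond in $G$, and, $u(G)$ denoting the number of sets in this partition, \[ \sigma_{(2,3)}(G)=\begin{cases} u(G)+1, & \text{if } G \text{ is isomorphic to } N_k \text{ for some } k\ge 2,\\ u(G), & \text{otherwise.}\end{cases} \] -/

import Mathlib

namespace SimpleGraph

variable {V : Type*}

/-- One round of the `(p,q)`-spreading colour change rule, `S` being the set of blue vertices:
a white vertex `w` becomes blue if it has at least `p` blue neighbours and one of its blue
neighbours has at most `q` white neighbours. -/
def spreadStep (G : SimpleGraph V) (p : ℕ) (q : ℕ∞) (S : Set V) : Set V :=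
  S ∪ {w | w ∉ S ∧ (p : ℕ∞) ≤ (G.neighborSet w ∩ S).encard ∧
    ∃ u ∈ G.neighborSet w ∩ S, (G.neighborSet u \ S).encard ≤ q}

/-- `S` is a `(p,q)`-spreading set: repeated application of the rule colours all vertices blue. -/
def IsSpreadingSet (G : SimpleGraph V) (p : ℕ) (q : ℕ∞) (S : Set V) : Prop :=
  ∃ n : ℕ, (G.spreadStep p q)^[n] S = Set.univ

/-- The `(p,q)`-spreading number `σ_(p,q)(G)` of a finite graph: the minimum cardinality of a
`(p,q)`-spreading set (the set of all vertices is always one). -/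
noncomputable def spreadingNumber (G : SimpleGraph V) (p : ℕ) (q : ℕ∞) : ℕ :=
  sInf {n | ∃ S : Finset V, G.IsSpreadingSet p q (S : Set V) ∧ S.card = n}

/-- One round of the `r`-percolation rule: a white vertex with at least `r` blue neighbours
becomes blue. -/
def percolationStep (G : SimpleGraph V) (r : ℕ) (S : Set V) : Set V :=
  S ∪ {w | w ∉ S ∧ (r : ℕ∞) ≤ (G.neighborSet w ∩ S).encard}

/-- `S` is an `r`-percolating set: repeated application of the rule colours all vertices blue. -/
def IsPercolatingSet (G : SimpleGraph V) (r : ℕ) (S : Set V) : Prop :=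
  ∃ n : ℕ, (G.percolationStep r)^[n] S = Set.univ

/-- `G` has no induced subgraph isomorphic to `K_{1,3}`. -/
def IsClawFree (G : SimpleGraph V) : Prop :=
  IsEmpty (completeBipartiteGraph (Fin 1) (Fin 3) ↪g G)

/-- The diamond `K₄ - e`; the missing edge joins `0` and `1`. -/
def diamondGraph : SimpleGraph (Fin 4) :=
  (completeGraph (Fin 4)).deleteEdges {s(0, 1)}

/-- The set `U` induces a triangle in `G`. -/
def InducesTriangle (G : SimpleGraph V) (U : Set V) : Prop :=
  Nonempty (G.induce U ≃g completeGraph (Fin 3))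

/-- The set `U` induces a diamond in `G`. -/
def InducesDiamond (G : SimpleGraph V) (U : Set V) : Prop :=
  Nonempty (G.induce U ≃g diamondGraph)

/-- `P` is a triangle-diamond partition of `G`: a partition of the vertex set into sets
(the units), each of which induces a triangle or a diamond. -/
def IsTriangleDiamondPartition (G : SimpleGraph V) (P : Set (Set V)) : Prop :=
  Setoid.IsPartition P ∧ ∀ U ∈ P, G.InducesTriangle U ∨ G.InducesDiamond U

/-- `u(G)`, the number of units of the triangle-diamond partition of a finite graph `G`.
When that partition is unique, the set below has exactly one element. -/
noncomputable def numUnits (G : SimpleGraph V) : ℕ :=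
  sInf {n | ∃ P : Set (Set V), G.IsTriangleDiamondPartition P ∧ P.ncard = n}

/-- The diamond-necklace `N_k` (for `k ≥ 2`): the vertices `(i, 0), (i, 1), (i, 2), (i, 3)` are
`a_i, b_i, c_i, d_i`; they form a diamond with missing edge `a_i b_i`, and `a_i` is joined to
`b_{i+1}`, the indices being taken modulo `k`. -/
def diamondNecklace (k : ℕ) : SimpleGraph (ZMod k × Fin 4) :=
  SimpleGraph.fromRel fun x y =>
    (x.1 = y.1 ∧ diamondGraph.Adj x.2 y.2) ∨ (x.2 = 0 ∧ y.2 = 1 ∧ y.1 = x.1 + 1)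

/-- `G` is (isomorphic to) a diamond-necklace `N_k` with `k ≥ 2`. -/
def IsDiamondNecklace (G : SimpleGraph V) : Prop :=
  ∃ k : ℕ, 2 ≤ k ∧ Nonempty (G ≃g diamondNecklace k)

end SimpleGraph

namespace SimpleGraph

variable {V : Type*}

/-! ### Cubic graphs and percolation closures -/

/-! In a cubic graph a blue vertex never has more than three white neighbours, so the `q = 3` clause
is vacuous and the two rules coincide. `Blue` records the final colouring as an inductive closure.

Claw-freeness puts every vertex in a triangle, and outside `K₄` two triangles sharing an edge form
an induced diamond. The units are exactly the triangles and diamonds that are closed under following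
edges of triangles; `IsCubic.exists_partition` and `IsCubic.partition_unique` rest on this.

Lower bound: a vertex has at most one neighbour outside its unit, so a unit without a seed stays
white (`IsCubic.inter_nonempty_of_blue`). If all units are diamonds, one seed per unit is too few:
each seed must be a middle vertex, and then no white vertex has two blue neighbours
(`IsCubic.not_subsingleton_of_blue`).

Upper bound: a unit touched by a blue vertex needs only one well-chosen seed (`exists_seeds`), so by
connectedness only the starting unit costs extra. A diamond can be started with two seeds. A
triangle can be started with the single seed `x` unless the edge leaving it at `x` is a bridge;
`IsCubic.exists_not_isCut` finds a triangle and a vertex `x` where it is not, by descent on the size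
of one side of a bridge.

Finally, a connected graph all of whose units are diamonds is a necklace
(`IsCubic.isDiamondNecklace`): exchanging the ends of a diamond and crossing the edge leaving it are
involutions whose composite walks once round the cycle. -/

/-- Every vertex has exactly three neighbours. -/
def IsCubic (G : SimpleGraph V) : Prop :=
  ∀ v, ∃ a b c, a ≠ b ∧ a ≠ c ∧ b ≠ c ∧ ∀ w, G.Adj v w ↔ w = a ∨ w = b ∨ w = c

theorem IsRegularOfDegree.isCubic {G : SimpleGraph V} [G.LocallyFinite]
    (h : G.IsRegularOfDegree 3) : G.IsCubic := by
  classical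
  intro v
  obtain ⟨a, b, c, hab, hac, hbc, he⟩ := Finset.card_eq_three.1 (h v)
  refine ⟨a, b, c, hab, hac, hbc, fun w => ?_⟩
  rw [← mem_neighborFinset, he]
  simp

theorem IsCubic.eq_of_adj {G : SimpleGraph V} (h : G.IsCubic) {v a b c w : V}
    (ha : G.Adj v a) (hb : G.Adj v b) (hc : G.Adj v c) (hab : a ≠ b) (hac : a ≠ c) (hbc : b ≠ c)
    (hw : G.Adj v w) : w = a ∨ w = b ∨ w = c := by
  obtain ⟨p, q, r, -, -, -, hv⟩ := h v
  rw [hv] at ha hb hc hw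
  grind

theorem IsCubic.exists_third {G : SimpleGraph V} (h : G.IsCubic) {v : V} (a b : V) :
    ∃ c, G.Adj v c ∧ c ≠ a ∧ c ≠ b := by
  obtain ⟨p, q, r, hpq, hpr, hqr, hv⟩ := h v
  have hp := (hv p).2 (by simp)
  have hq := (hv q).2 (by simp)
  have hr := (hv r).2 (by simp)
  by_cases h1 : p = a ∨ p = b
  · by_cases h2 : q = a ∨ q = b
    · exact ⟨r, hr, by grind, by grind⟩
    · exact ⟨q, hq, by grind, by grind⟩
  · exact ⟨p, hp, by grind, by grind⟩

theorem IsCubic.encard_neighborSet {G : SimpleGraph V} (h : G.IsCubic) (v : V) :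
    (G.neighborSet v).encard = 3 := by
  obtain ⟨a, b, c, hab, hac, hbc, hv⟩ := h v
  refine Set.encard_eq_three.2 ⟨a, b, c, hab, hac, hbc, ?_⟩
  ext w
  simp [hv]

/-- The vertices coloured blue by the `2`-percolation rule, starting from `S`. -/
inductive Blue (G : SimpleGraph V) (S : Set V) : V → Prop
  | seed {v : V} : v ∈ S → Blue G S v
  | step {w a b : V} : G.Adj w a → G.Adj w b → a ≠ b → Blue G S a → Blue G S b → Blue G S w

theorem two_le_encard_neighborSet_inter {G : SimpleGraph V} {w : V} {S : Set V} :
    ((2 : ℕ) : ℕ∞) ≤ (G.neighborSet w ∩ S).encard ↔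
      ∃ a b, G.Adj w a ∧ G.Adj w b ∧ a ≠ b ∧ a ∈ S ∧ b ∈ S := by
  have h2 : ((2 : ℕ) : ℕ∞) = 1 + 1 := by norm_num
  rw [h2, ENat.add_one_le_iff (by simp), Set.one_lt_encard_iff]
  simp only [Set.mem_inter_iff, mem_neighborSet]
  constructor
  · rintro ⟨a, b, ha, hb, hab⟩
    exact ⟨a, b, ha.1, hb.1, hab, ha.2, hb.2⟩
  · rintro ⟨a, b, ha, hb, hab, ha', hb'⟩
    exact ⟨a, b, ⟨ha, ha'⟩, ⟨hb, hb'⟩, hab⟩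

theorem IsCubic.spreadStep_eq {G : SimpleGraph V} (h : G.IsCubic) (S : Set V) :
    G.spreadStep 2 3 S = G.percolationStep 2 S := by
  unfold spreadStep percolationStep
  congr 1
  ext w
  simp only [Set.mem_ofPred_eq]
  refine and_congr_right fun _ => and_iff_left_of_imp fun h2 => ?_
  obtain ⟨a, -, ha, -, -, hS, -⟩ := two_le_encard_neighborSet_inter.1 h2
  refine ⟨a, ⟨ha, hS⟩, ?_⟩
  exact (Set.encard_le_encard Set.sdiff_subset).trans (h.encard_neighborSet a).le

theorem IsCubic.isSpreadingSet_iff {G : SimpleGraph V} (h : G.IsCubic) (S : Set V) :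
    G.IsSpreadingSet 2 3 S ↔ G.IsPercolatingSet 2 S := by
  have : G.spreadStep 2 3 = G.percolationStep 2 := funext h.spreadStep_eq
  simp only [IsSpreadingSet, IsPercolatingSet, this]

theorem percolationStep_iterate_mono (G : SimpleGraph V) (r : ℕ) (S : Set V) :
    Monotone fun n => (G.percolationStep r)^[n] S := by
  refine monotone_nat_of_le_succ fun n => ?_
  rw [Function.iterate_succ_apply']
  exact Set.subset_union_left

theorem Blue.exists_iterate {G : SimpleGraph V} {S : Set V} {v : V} (h : G.Blue S v) :
    ∃ n, v ∈ (G.percolationStep 2)^[n] S := by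
  induction h with
  | seed hv => exact ⟨0, hv⟩
  | @step w a b ha hb hab _ _ iha ihb =>
    obtain ⟨m, hm⟩ := iha
    obtain ⟨n, hn⟩ := ihb
    have hm' := percolationStep_iterate_mono G 2 S (le_max_left m n) hm
    have hn' := percolationStep_iterate_mono G 2 S (le_max_right m n) hn
    refine ⟨max m n + 1, ?_⟩
    rw [Function.iterate_succ_apply']
    by_cases hw : w ∈ (G.percolationStep 2)^[max m n] S
    · exact Or.inl hw
    · exact Or.inr ⟨hw, two_le_encard_neighborSet_inter.2 ⟨a, b, ha, hb, hab, hm', hn'⟩⟩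

theorem blue_of_mem_iterate {G : SimpleGraph V} {S : Set V} (n : ℕ) :
    ∀ v ∈ (G.percolationStep 2)^[n] S, G.Blue S v := by
  induction n with
  | zero => exact fun v hv => .seed hv
  | succ n ih =>
    intro v hv
    rw [Function.iterate_succ_apply'] at hv
    rcases hv with hv | ⟨-, hv⟩
    · exact ih v hv
    · obtain ⟨a, b, ha, hb, hab, ha', hb'⟩ := two_le_encard_neighborSet_inter.1 hv
      exact .step ha hb hab (ih a ha') (ih b hb')

theorem isPercolatingSet_two_iff [Finite V] {G : SimpleGraph V} {S : Set V} :
    G.IsPercolatingSet 2 S ↔ ∀ v, G.Blue S v := by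
  constructor
  · rintro ⟨n, hn⟩ v
    exact blue_of_mem_iterate n v (hn ▸ Set.mem_univ v)
  · intro h
    choose n hn using fun v => (h v).exists_iterate
    obtain ⟨N, hN⟩ := (Set.finite_range n).bddAbove
    exact ⟨N, Set.eq_univ_of_forall fun v =>
      percolationStep_iterate_mono G 2 S (hN ⟨v, rfl⟩) (hn v)⟩

/-- Any superset of the seeds that is stable under the rule bounds the colouring from above. The
lower bounds use it with `T` the complement of a unit and with `T = S`. -/
theorem Blue.mem_of_closed {G : SimpleGraph V} {S T : Set V} (hST : S ⊆ T)
    (hT : ∀ w a b, G.Adj w a → G.Adj w b → a ≠ b → a ∈ T → b ∈ T → w ∈ T) {v : V}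
    (h : G.Blue S v) : v ∈ T := by
  induction h with
  | seed hv => exact hST hv
  | step ha hb hab _ _ iha ihb => exact hT _ _ _ ha hb hab iha ihb

theorem Blue.mono {G : SimpleGraph V} {S T : Set V} (hST : S ⊆ T) {v : V} (h : G.Blue S v) :
    G.Blue T v :=
  h.mem_of_closed (T := {v | G.Blue T v}) (fun _ hv => .seed (hST hv))
    fun _ _ _ ha hb hab ha' hb' => Blue.step ha hb hab ha' hb'

theorem Connected.mem_of_closed {G : SimpleGraph V} (h : G.Connected) {T : Set V} {v : V}
    (hv : v ∈ T) (hT : ∀ a b, G.Adj a b → a ∈ T → b ∈ T) (w : V) : w ∈ T := by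
  obtain ⟨p⟩ := h.preconnected v w
  induction p with
  | nil => exact hv
  | cons hab _ ih => exact ih (hT _ _ hab hv)

/-! ### Triangles and diamonds -/

/-- The set `U` is the vertex set of a triangle. -/
def IsTriangleSet (G : SimpleGraph V) (U : Set V) : Prop :=
  ∃ x y z, G.Adj x y ∧ G.Adj x z ∧ G.Adj y z ∧ U = {x, y, z}

/-- The vertices `a, b, c, d` induce a diamond with missing edge `ab`. -/
structure IsDiamond (G : SimpleGraph V) (a b c d : V) : Prop where
  ac : G.Adj a c
  ad : G.Adj a d
  bc : G.Adj b c
  bd : G.Adj b d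
  cd : G.Adj c d
  ne : a ≠ b
  not_adj : ¬ G.Adj a b

theorem IsDiamond.injective {G : SimpleGraph V} {a b c d : V} (h : G.IsDiamond a b c d) :
    Function.Injective ![a, b, c, d] := by
  intro i j hij
  fin_cases i <;> fin_cases j <;>
    simp [h.ac.ne, h.ad.ne, h.bc.ne, h.bd.ne, h.cd.ne, h.ac.ne', h.ad.ne', h.bc.ne', h.bd.ne',
      h.cd.ne', h.ne, h.ne.symm] at hij ⊢

theorem IsDiamond.adj_iff {G : SimpleGraph V} {a b c d : V} (h : G.IsDiamond a b c d)
    (i j : Fin 4) : G.Adj (![a, b, c, d] i) (![a, b, c, d] j) ↔ diamondGraph.Adj i j := by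
  have h1 := h.not_adj
  have h2 : ¬ G.Adj b a := fun hh => h1 hh.symm
  fin_cases i <;> fin_cases j <;>
    simp [diamondGraph, h.ac, h.ad, h.bc, h.bd, h.cd, h.ac.symm, h.ad.symm, h.bc.symm, h.bd.symm,
      h.cd.symm, h1, h2]

/-- The set `U` is the vertex set of an induced diamond. -/
def IsDiamondSet (G : SimpleGraph V) (U : Set V) : Prop :=
  ∃ a b c d, G.IsDiamond a b c d ∧ U = {a, b, c, d}

theorem inducesTriangle_iff {G : SimpleGraph V} {U : Set V} :
    G.InducesTriangle U ↔ G.IsTriangleSet U := by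
  constructor
  · rintro ⟨e⟩
    have hadj : ∀ i j : Fin 3, i ≠ j → G.Adj (e.symm i) (e.symm j) := fun i j hij =>
      (e.symm.map_adj_iff (v := i) (w := j)).2 hij
    refine ⟨e.symm 0, e.symm 1, e.symm 2, hadj _ _ (by decide), hadj _ _ (by decide),
      hadj _ _ (by decide), ?_⟩
    ext v
    constructor
    · intro hv
      obtain ⟨i, hi⟩ := e.symm.surjective ⟨v, hv⟩
      have hi' : v = (e.symm i : V) := by rw [hi]
      rw [hi']
      fin_cases i <;> simp
    · rintro (rfl | rfl | rfl) <;> exact Subtype.coe_prop _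
  · rintro ⟨x, y, z, hxy, hxz, hyz, rfl⟩
    have hf : ∀ i : Fin 3, ![x, y, z] i ∈ ({x, y, z} : Set V) := by
      intro i; fin_cases i <;> simp
    have h1 := hxy.ne
    have h2 := hxz.ne
    have h3 := hyz.ne
    let f : Fin 3 → ({x, y, z} : Set V) := fun i => ⟨![x, y, z] i, hf i⟩
    have hinj : Function.Injective f := by
      intro i j hij
      have := congrArg Subtype.val hij
      fin_cases i <;> fin_cases j <;> simp_all [f]
    have hsurj : Function.Surjective f := by
      rintro ⟨v, rfl | rfl | rfl⟩
      exacts [⟨0, rfl⟩, ⟨1, rfl⟩, ⟨2, rfl⟩]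
    refine ⟨RelIso.symm ⟨Equiv.ofBijective f ⟨hinj, hsurj⟩, ?_⟩⟩
    intro i j
    change G.Adj (![x, y, z] i) (![x, y, z] j) ↔ _
    fin_cases i <;> fin_cases j <;> simp [hxy, hxz, hyz, hxy.symm, hxz.symm, hyz.symm]

theorem inducesDiamond_iff {G : SimpleGraph V} {U : Set V} :
    G.InducesDiamond U ↔ G.IsDiamondSet U := by
  constructor
  · rintro ⟨e⟩
    have hadj : ∀ i j : Fin 4, diamondGraph.Adj i j ↔ G.Adj (e.symm i) (e.symm j) := fun i j =>
      (e.symm.map_adj_iff (v := i) (w := j)).symm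
    refine ⟨e.symm 0, e.symm 1, e.symm 2, e.symm 3, ⟨?_, ?_, ?_, ?_, ?_, ?_, ?_⟩, ?_⟩
    any_goals rw [← hadj]; simp [diamondGraph]
    · intro h
      have := e.symm.injective (Subtype.ext h)
      simp at this
    ext v
    constructor
    · intro hv
      obtain ⟨i, hi⟩ := e.symm.surjective ⟨v, hv⟩
      have hi' : v = (e.symm i : V) := by rw [hi]
      rw [hi']
      fin_cases i <;> simp
    · rintro (rfl | rfl | rfl | rfl) <;> exact Subtype.coe_prop _
  · rintro ⟨x, y, z, w, h, rfl⟩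
    have hf : ∀ i : Fin 4, ![x, y, z, w] i ∈ ({x, y, z, w} : Set V) := by
      intro i; fin_cases i <;> simp
    let f : Fin 4 → ({x, y, z, w} : Set V) := fun i => ⟨![x, y, z, w] i, hf i⟩
    have hinj : Function.Injective f := fun i j hij => h.injective (congrArg Subtype.val hij)
    have hsurj : Function.Surjective f := by
      rintro ⟨v, rfl | rfl | rfl | rfl⟩
      exacts [⟨0, rfl⟩, ⟨1, rfl⟩, ⟨2, rfl⟩, ⟨3, rfl⟩]
    exact ⟨RelIso.symm ⟨Equiv.ofBijective f ⟨hinj, hsurj⟩, fun {i j} => h.adj_iff i j⟩⟩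

theorem IsTriangleSet.exists_of_mem {G : SimpleGraph V} {U : Set V} (h : G.IsTriangleSet U)
    {v : V} (hv : v ∈ U) : ∃ y z, G.Adj v y ∧ G.Adj v z ∧ G.Adj y z ∧ U = {v, y, z} := by
  obtain ⟨x, y, z, hxy, hxz, hyz, rfl⟩ := h
  rcases hv with rfl | rfl | rfl
  · exact ⟨y, z, hxy, hxz, hyz, rfl⟩
  · exact ⟨x, z, hxy.symm, hyz, hxz, by grind⟩
  · exact ⟨x, y, hxz.symm, hyz.symm, hxy, by grind⟩

theorem IsDiamond.swap_ends {G : SimpleGraph V} {a b c d : V} (h : G.IsDiamond a b c d) :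
    G.IsDiamond b a c d :=
  ⟨h.bc, h.bd, h.ac, h.ad, h.cd, h.ne.symm, fun hh => h.not_adj hh.symm⟩

theorem IsDiamond.swap_mid {G : SimpleGraph V} {a b c d : V} (h : G.IsDiamond a b c d) :
    G.IsDiamond a b d c :=
  ⟨h.ad, h.ac, h.bd, h.bc, h.cd.symm, h.ne, h.not_adj⟩

theorem IsDiamondSet.exists_of_mem {G : SimpleGraph V} {U : Set V} (h : G.IsDiamondSet U)
    {v : V} (hv : v ∈ U) : (∃ b c d, G.IsDiamond v b c d ∧ U = {v, b, c, d}) ∨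
      ∃ a b d, G.IsDiamond a b v d ∧ U = {a, b, v, d} := by
  obtain ⟨a, b, c, d, h, rfl⟩ := h
  rcases hv with rfl | rfl | rfl | rfl
  · exact Or.inl ⟨b, c, d, h, rfl⟩
  · exact Or.inl ⟨a, c, d, h.swap_ends, by grind⟩
  · exact Or.inr ⟨a, b, d, h, rfl⟩
  · exact Or.inr ⟨a, b, c, h.swap_mid, by grind⟩

/-- The set `U` is the vertex set of a triangle or of an induced diamond. -/
def IsUnitSet (G : SimpleGraph V) (U : Set V) : Prop :=
  G.IsTriangleSet U ∨ G.IsDiamondSet U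

theorem isTriangleDiamondPartition_iff {G : SimpleGraph V} {P : Set (Set V)} :
    G.IsTriangleDiamondPartition P ↔ Setoid.IsPartition P ∧ ∀ U ∈ P, G.IsUnitSet U := by
  simp only [IsTriangleDiamondPartition, inducesTriangle_iff, inducesDiamond_iff, IsUnitSet]

/-- The set `U` is closed under following edges that lie in triangles. -/
def TriangleClosed (G : SimpleGraph V) (U : Set V) : Prop :=
  ∀ u w t, u ∈ U → G.Adj u w → G.Adj t u → G.Adj t w → w ∈ U

/-- Any two vertices of a unit are linked by a chain of edges lying in triangles of that unit. Hence
a triangle-closed unit is the least triangle-closed set containing any of its vertices. -/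
theorem IsUnitSet.subset_of_triangleClosed {G : SimpleGraph V} {U T : Set V} (hU : G.IsUnitSet U)
    (hT : G.TriangleClosed T) {v : V} (hvU : v ∈ U) (hvT : v ∈ T) : U ⊆ T := by
  rcases hU with hU | hU
  · obtain ⟨y, z, hy, hz, hyz, rfl⟩ := hU.exists_of_mem hvU
    rintro w (rfl | rfl | rfl)
    exacts [hvT, hT _ _ _ hvT hy hz.symm hyz.symm, hT _ _ _ hvT hz hy.symm hyz]
  · rcases hU.exists_of_mem hvU with ⟨b, c, d, h, rfl⟩ | ⟨a, b, d, h, rfl⟩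
    · have hc := hT _ _ _ hvT h.ac h.ad.symm h.cd.symm
      rintro w (rfl | rfl | rfl | rfl)
      exacts [hvT, hT _ _ _ hc h.bc.symm h.cd.symm h.bd.symm, hc,
        hT _ _ _ hvT h.ad h.ac.symm h.cd]
    · rintro w (rfl | rfl | rfl | rfl)
      exacts [hT _ _ _ hvT h.ac.symm h.cd.symm h.ad.symm,
        hT _ _ _ hvT h.bc.symm h.cd.symm h.bd.symm, hvT, hT _ _ _ hvT h.cd h.ac h.ad]

theorem IsUnitSet.eq_of_mem {G : SimpleGraph V} {U T : Set V} (hU : G.IsUnitSet U)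
    (hU' : G.TriangleClosed U) (hT : G.IsUnitSet T) (hT' : G.TriangleClosed T) {v : V}
    (hvU : v ∈ U) (hvT : v ∈ T) : U = T :=
  (hU.subset_of_triangleClosed hT' hvU hvT).antisymm (hT.subset_of_triangleClosed hU' hvT hvU)

theorem IsUnitSet.exists_adj {G : SimpleGraph V} {U : Set V} (hU : G.IsUnitSet U) {v : V}
    (hv : v ∈ U) : ∃ a ∈ U, ∃ b ∈ U, a ≠ b ∧ G.Adj v a ∧ G.Adj v b := by
  rcases hU with hU | hU
  · obtain ⟨y, z, hy, hz, hyz, rfl⟩ := hU.exists_of_mem hv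
    exact ⟨y, by simp, z, by simp, hyz.ne, hy, hz⟩
  · rcases hU.exists_of_mem hv with ⟨b, c, d, h, rfl⟩ | ⟨a, b, d, h, rfl⟩
    · exact ⟨c, by simp, d, by simp, h.cd.ne, h.ac, h.ad⟩
    · exact ⟨a, by simp, b, by simp, h.ne, h.ac.symm, h.bc.symm⟩

/-- A vertex of a unit has at most one neighbour outside this unit. -/
theorem IsCubic.eq_of_adj_of_notMem {G : SimpleGraph V} (hG : G.IsCubic) {U : Set V}
    (hU : G.IsUnitSet U) {v w w' : V} (hv : v ∈ U) (hw : G.Adj v w) (hwU : w ∉ U)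
    (hw' : G.Adj v w') (hwU' : w' ∉ U) : w = w' := by
  obtain ⟨a, ha, b, hb, hab, hva, hvb⟩ := hU.exists_adj hv
  rcases hG.eq_of_adj hva hvb hw hab (by grind) (by grind) hw' with h | h | h <;> grind

/-! ### Uniqueness of the partition into units -/

section Partition

variable {G : SimpleGraph V} {P : Set (Set V)}

/-- If a triangle `u, w, t` had `u` in the unit and `w` outside, `t` would be inside, since `u` has
only one outer neighbour; but then `w` would have two neighbours, `u` and `t`, outside its own unit.
-/
theorem IsCubic.triangleClosed_of_mem (hG : G.IsCubic) (hP : Setoid.IsPartition P)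
    (hu : ∀ U ∈ P, G.IsUnitSet U) {U : Set V} (hU : U ∈ P) : G.TriangleClosed U := by
  intro u w t huU huw htu htw
  by_contra hw
  have ht : t ∈ U := by
    by_contra ht
    exact htw.ne (hG.eq_of_adj_of_notMem (hu U hU) huU htu.symm ht huw hw)
  obtain ⟨W, ⟨hW, hwW⟩, -⟩ := hP.2 w
  have hdisj : ∀ v ∈ U, v ∉ W := by
    intro v hvU hvW
    have := (hP.2 v).unique ⟨hU, hvU⟩ ⟨hW, hvW⟩
    exact hw (this ▸ hwW)
  exact htu.ne (hG.eq_of_adj_of_notMem (hu W hW) hwW htw.symm (hdisj t ht) huw.symm (hdisj u huU))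

theorem IsCubic.partition_unique (hG : G.IsCubic) {P' : Set (Set V)}
    (hP : G.IsTriangleDiamondPartition P) (hP' : G.IsTriangleDiamondPartition P') : P = P' := by
  rw [isTriangleDiamondPartition_iff] at hP hP'
  have key : ∀ {Q Q' : Set (Set V)}, (Setoid.IsPartition Q ∧ ∀ U ∈ Q, G.IsUnitSet U) →
      (Setoid.IsPartition Q' ∧ ∀ U ∈ Q', G.IsUnitSet U) → Q ⊆ Q' := by
    intro Q Q' hQ hQ' U hU
    obtain ⟨v, hv⟩ := Setoid.nonempty_of_mem_partition hQ.1 hU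
    obtain ⟨W, ⟨hW, hvW⟩, -⟩ := hQ'.1.2 v
    rwa [(hQ.2 U hU).eq_of_mem (hG.triangleClosed_of_mem hQ.1 hQ.2 hU) (hQ'.2 W hW)
      (hG.triangleClosed_of_mem hQ'.1 hQ'.2 hW) hv hvW]
  exact (key hP hP').antisymm (key hP' hP)

end Partition

/-! ### Existence of the partition into units -/

theorem IsClawFree.exists_triangle {G : SimpleGraph V} (h : G.IsClawFree) (hG : G.IsCubic)
    (v : V) : ∃ y z, G.Adj v y ∧ G.Adj v z ∧ G.Adj y z := by
  obtain ⟨a, b, c, hab, hac, hbc, hv⟩ := hG v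
  by_contra! hcon
  have ha := (hv a).2 (by simp)
  have hb := (hv b).2 (by simp)
  have hc := (hv c).2 (by simp)
  have h1 := hcon a b ha hb
  have h2 := hcon a c ha hc
  have h3 := hcon b c hb hc
  have h1' : ¬ G.Adj b a := fun hh => h1 hh.symm
  have h2' : ¬ G.Adj c a := fun hh => h2 hh.symm
  have h3' : ¬ G.Adj c b := fun hh => h3 hh.symm
  refine h.false ⟨⟨Sum.elim (fun _ => v) ![a, b, c], ?_⟩, ?_⟩
  · rintro (i | i) (j | j) hij
    · exact congrArg _ (Subsingleton.elim i j)
    · fin_cases j <;> simp [ha.ne, hb.ne, hc.ne] at hij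
    · fin_cases i <;> simp [ha.ne', hb.ne', hc.ne'] at hij
    · fin_cases i <;> fin_cases j <;>
        simp [hab, hac, hbc, hab.symm, hac.symm, hbc.symm] at hij ⊢
  · intro i j
    change G.Adj (Sum.elim (fun _ => v) ![a, b, c] i) (Sum.elim (fun _ => v) ![a, b, c] j) ↔ _
    rcases i with i | i <;> rcases j with j | j
    · simp
    · fin_cases j <;> simp [ha, hb, hc]
    · fin_cases i <;> simp [ha.symm, hb.symm, hc.symm]
    · fin_cases i <;> fin_cases j <;> simp [h1, h2, h3, h1', h2', h3']

/-- A connected cubic graph containing four mutually adjacent vertices is `K₄`. -/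
theorem IsCubic.iso_completeGraph {G : SimpleGraph V} (hG : G.IsCubic) (hconn : G.Connected)
    {x y z w : V} (hxy : G.Adj x y) (hxz : G.Adj x z) (hxw : G.Adj x w) (hyz : G.Adj y z)
    (hyw : G.Adj y w) (hzw : G.Adj z w) : Nonempty (G ≃g completeGraph (Fin 4)) := by
  classical
  have hmem : ∀ v, v ∈ ({x, y, z, w} : Finset V) := by
    intro v
    have := hconn.mem_of_closed (T := {x, y, z, w}) (v := x) (by simp) (by
      rintro a b hab (rfl | rfl | rfl | rfl)
      · rcases hG.eq_of_adj hxy hxz hxw hyz.ne hyw.ne hzw.ne hab with h | h | h <;> simp [h]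
      · rcases hG.eq_of_adj hxy.symm hyz hyw hxz.ne hxw.ne hzw.ne hab with h | h | h <;> simp [h]
      · rcases hG.eq_of_adj hxz.symm hyz.symm hzw hxy.ne hxw.ne hyw.ne hab with h | h | h <;>
          simp [h]
      · rcases hG.eq_of_adj hxw.symm hyw.symm hzw.symm hxy.ne hxz.ne hyz.ne hab with h | h | h <;>
          simp [h]) v
    simpa using this
  let _ : Fintype V := ⟨{x, y, z, w}, hmem⟩
  have hcard : Fintype.card V = 4 := by
    change ({x, y, z, w} : Finset V).card = 4
    have := hxy.ne
    have := hxz.ne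
    have := hxw.ne
    have := hyz.ne
    have := hyw.ne
    have := hzw.ne
    simp [*]
  refine ⟨Fintype.equivFinOfCardEq hcard, ?_⟩
  intro a b
  have ha := hmem a
  have hb := hmem b
  simp only [Finset.mem_insert, Finset.mem_singleton] at ha hb
  simp only [completeGraph, top_adj, ne_eq, EmbeddingLike.apply_eq_iff_eq]
  refine ⟨fun hne => ?_, fun h => h.ne⟩
  rcases ha with rfl | rfl | rfl | rfl <;> rcases hb with rfl | rfl | rfl | rfl <;>
    first
    | exact absurd rfl hne
    | assumption
    | (apply G.adj_symm; assumption)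

/-- The ends `z`, `w` are not adjacent, as that would give `K₄`. The middle vertices `x`, `y` have
all their neighbours inside, so an edge leaving the diamond starts at an end and has no common
neighbour to complete a triangle. -/
theorem IsCubic.isUnitSet_of_common_neighbour {G : SimpleGraph V} (hG : G.IsCubic)
    (hconn : G.Connected) (hK : IsEmpty (G ≃g completeGraph (Fin 4))) {x y z w : V}
    (hxy : G.Adj x y) (hxz : G.Adj x z) (hyz : G.Adj y z) (hwx : G.Adj w x) (hwy : G.Adj w y)
    (hwz : w ≠ z) : G.IsUnitSet {z, w, x, y} ∧ G.TriangleClosed {z, w, x, y} := by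
  have hzw : ¬ G.Adj z w := fun h =>
    (not_nonempty_iff.2 hK) (hG.iso_completeGraph hconn hxy hxz hwx.symm hyz hwy.symm h)
  refine ⟨Or.inr ⟨z, w, x, y, ⟨hxz.symm, hyz.symm, hwx, hwy, hxy, hwz.symm, hzw⟩, rfl⟩, ?_⟩
  have hx : ∀ v, G.Adj x v → v = y ∨ v = z ∨ v = w := fun v hv =>
    hG.eq_of_adj hxy hxz hwx.symm hyz.ne hwy.ne' hwz.symm hv
  have hy : ∀ v, G.Adj y v → v = x ∨ v = z ∨ v = w := fun v hv =>
    hG.eq_of_adj hxy.symm hyz hwy.symm hxz.ne hwx.ne' hwz.symm hv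
  intro u v t hu huv htu htv
  rcases hu with rfl | rfl | rfl | rfl
  · by_contra hv
    have ht := hG.eq_of_adj hxz.symm hyz.symm huv hxy.ne (by grind) (by grind) htu.symm
    rcases ht with rfl | rfl | rfl
    · grind
    · grind
    · exact htv.ne rfl
  · by_contra hv
    have ht := hG.eq_of_adj hwx hwy huv hxy.ne (by grind) (by grind) htu.symm
    rcases ht with rfl | rfl | rfl
    · grind
    · grind
    · exact htv.ne rfl
  · grind
  · grind

theorem IsCubic.exists_isUnitSet {G : SimpleGraph V} (hG : G.IsCubic) (hconn : G.Connected)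
    (hcf : G.IsClawFree) (hK : IsEmpty (G ≃g completeGraph (Fin 4))) (v : V) :
    ∃ U, v ∈ U ∧ G.IsUnitSet U ∧ G.TriangleClosed U := by
  obtain ⟨y, z, hvy, hvz, hyz⟩ := hcf.exists_triangle hG v
  by_cases h1 : ∃ w, G.Adj w v ∧ G.Adj w y ∧ w ≠ z
  · obtain ⟨w, hw1, hw2, hw3⟩ := h1
    exact ⟨_, by simp, hG.isUnitSet_of_common_neighbour hconn hK hvy hvz hyz hw1 hw2 hw3⟩
  by_cases h2 : ∃ w, G.Adj w v ∧ G.Adj w z ∧ w ≠ y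
  · obtain ⟨w, hw1, hw2, hw3⟩ := h2
    exact ⟨_, by simp, hG.isUnitSet_of_common_neighbour hconn hK hvz hvy hyz.symm hw1 hw2 hw3⟩
  by_cases h3 : ∃ w, G.Adj w y ∧ G.Adj w z ∧ w ≠ v
  · obtain ⟨w, hw1, hw2, hw3⟩ := h3
    exact ⟨_, by simp, hG.isUnitSet_of_common_neighbour hconn hK hyz hvy.symm hvz.symm hw1 hw2 hw3⟩
  push Not at h1 h2 h3
  refine ⟨{v, y, z}, by simp, Or.inl ⟨v, y, z, hvy, hvz, hyz, rfl⟩, ?_⟩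
  intro u w t hu huw htu htw
  by_contra hw
  simp only [Set.mem_insert_iff, Set.mem_singleton_iff, not_or] at hw
  have := htw.symm
  rcases hu with rfl | rfl | rfl
  · have ht := hG.eq_of_adj hvy hvz huw hyz.ne (by grind) (by grind) htu.symm
    have := htw.ne
    have := huw.symm
    grind
  · have ht := hG.eq_of_adj hvy.symm hyz huw hvz.ne (by grind) (by grind) htu.symm
    have := htw.ne
    have := huw.symm
    grind
  · have ht := hG.eq_of_adj hvz.symm hyz.symm huw hvy.ne (by grind) (by grind) htu.symm
    have := htw.ne
    have := huw.symm
    grind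

theorem IsCubic.exists_partition {G : SimpleGraph V} (hG : G.IsCubic) (hconn : G.Connected)
    (hcf : G.IsClawFree) (hK : IsEmpty (G ≃g completeGraph (Fin 4))) :
    ∃ P, G.IsTriangleDiamondPartition P := by
  refine ⟨{U | G.IsUnitSet U ∧ G.TriangleClosed U}, isTriangleDiamondPartition_iff.2
    ⟨⟨?_, fun v => ?_⟩, fun U hU => hU.1⟩⟩
  · rintro ⟨⟨x, y, z, -, -, -, h⟩ | ⟨a, b, c, d, -, h⟩, -⟩
    · exact (h ▸ Set.mem_insert x _ : x ∈ (∅ : Set V)).elim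
    · exact (h ▸ Set.mem_insert a _ : a ∈ (∅ : Set V)).elim
  · obtain ⟨U, hvU, hU, hU'⟩ := hG.exists_isUnitSet hconn hcf hK v
    exact ⟨U, ⟨⟨hU, hU'⟩, hvU⟩, fun W hW => hW.1.1.eq_of_mem hW.1.2 hU hU' hW.2 hvU⟩

/-! ### Spreading blue vertices from unit to unit -/

/-- The seed depends on where the unit is touched. The blue neighbour `w` may itself lie in `U`,
which is why each case splits on `w` being one of the unit's vertices. -/
theorem IsUnitSet.exists_seed {G : SimpleGraph V} {U : Set V} (hU : G.IsUnitSet U) {v w : V}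
    (hv : v ∈ U) (hvw : G.Adj v w) :
    ∃ u ∈ U, ∀ S, G.Blue S w → G.Blue S u → ∀ x ∈ U, G.Blue S x := by
  rcases hU with hU | hU
  · obtain ⟨y, z, hy, hz, hyz, rfl⟩ := hU.exists_of_mem hv
    by_cases hwy : w = y
    · subst hwy
      refine ⟨z, by simp, fun S h1 h2 => ?_⟩
      rintro x (rfl | rfl | rfl)
      exacts [.step hy hz hyz.ne h1 h2, h1, h2]
    · refine ⟨y, by simp, fun S h1 h2 => ?_⟩
      have h3 := Blue.step hvw hy hwy h1 h2
      rintro x (rfl | rfl | rfl)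
      exacts [h3, h2, .step hz.symm hyz.symm hy.ne h3 h2]
  · rcases hU.exists_of_mem hv with ⟨b, c, d, h, rfl⟩ | ⟨a, b, d, h, rfl⟩
    · by_cases hwc : w = c
      · subst hwc
        refine ⟨d, by simp, fun S h1 h2 => ?_⟩
        rintro x (rfl | rfl | rfl | rfl)
        exacts [.step h.ac h.ad h.cd.ne h1 h2, .step h.bc h.bd h.cd.ne h1 h2, h1, h2]
      · refine ⟨c, by simp, fun S h1 h2 => ?_⟩
        have h3 := Blue.step hvw h.ac hwc h1 h2
        have h4 := Blue.step h.ad.symm h.cd.symm h.ac.ne h3 h2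
        rintro x (rfl | rfl | rfl | rfl)
        exacts [h3, .step h.bc h.bd h.cd.ne h2 h4, h2, h4]
    · by_cases hwd : w = d
      · subst hwd
        refine ⟨a, by simp, fun S h1 h2 => ?_⟩
        have h3 := Blue.step h.ac.symm h.cd h.ad.ne h2 h1
        rintro x (rfl | rfl | rfl | rfl)
        exacts [h2, .step h.bc h.bd h.cd.ne h3 h1, h3, h1]
      · refine ⟨d, by simp, fun S h1 h2 => ?_⟩
        have h3 := Blue.step hvw h.cd hwd h1 h2
        rintro x (rfl | rfl | rfl | rfl)
        exacts [.step h.ac h.ad h.cd.ne h3 h2, .step h.bc h.bd h.cd.ne h3 h2, h3, h2]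

/-! ### One seed per unit beyond the starting one -/

section Seeds

variable {G : SimpleGraph V} {P : Set (Set V)}

/-- Take a maximal family `R` of units of `Q` that can be made fully blue with at most one added
seed in each. A unit of `Q` outside `R` touched by a blue vertex could be added to `R` together with
its seed from `IsUnitSet.exists_seed`. -/
theorem exists_seeds [Finite V] (hP : Setoid.IsPartition P) (hu : ∀ U ∈ P, G.IsUnitSet U)
    {Q : Set (Set V)} (hQ : Q ⊆ P) (S₀ : Set V) :
    ∃ S₁ : Set V, S₁ ⊆ ⋃₀ Q ∧ (∀ U ∈ Q, (S₁ ∩ U).Subsingleton) ∧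
      ∀ U ∈ Q, ∀ v ∈ U, ∀ w, G.Adj v w → G.Blue (S₀ ∪ S₁) w → ∀ x ∈ U, G.Blue (S₀ ∪ S₁) x := by
  have hdisj : ∀ U ∈ P, ∀ W ∈ P, ∀ v, v ∈ U → v ∈ W → U = W := fun U hU W hW v hvU hvW =>
    (hP.2 v).unique ⟨hU, hvU⟩ ⟨hW, hvW⟩
  let F : Set (Set (Set V)) := {R | R ⊆ Q ∧ ∃ S₁ : Set V, S₁ ⊆ ⋃₀ R ∧
    (∀ U ∈ R, (S₁ ∩ U).Subsingleton) ∧ ∀ U ∈ R, ∀ x ∈ U, G.Blue (S₀ ∪ S₁) x}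
  have hne : F.Nonempty := ⟨∅, by simp, ∅, by simp, by simp, by simp⟩
  obtain ⟨R, ⟨hRQ, S₁, hS₁, hsub, hblue⟩, hmax⟩ := (Set.toFinite F).exists_maximal hne
  refine ⟨S₁, hS₁.trans (Set.sUnion_subset_sUnion hRQ), fun U hU => ?_, ?_⟩
  · intro s hs t ht
    obtain ⟨W, hW, hsW⟩ := hS₁ hs.1
    obtain rfl := hdisj W (hQ (hRQ hW)) U (hQ hU) s hsW hs.2
    exact hsub W hW hs ht
  intro U hU v hv w hvw hw
  by_cases hUR : U ∈ R
  · exact hblue U hUR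
  exfalso
  obtain ⟨u, huU, hseed⟩ := (hu U (hQ hU)).exists_seed hv hvw
  have hdisjU : ∀ W ∈ R, u ∉ W := fun W hW huW =>
    hUR (hdisj W (hQ (hRQ hW)) U (hQ hU) u huW huU ▸ hW)
  have hmono : S₀ ∪ S₁ ⊆ S₀ ∪ insert u S₁ :=
    Set.union_subset_union_right _ (Set.subset_insert _ _)
  have hmem : insert U R ∈ F := by
    refine ⟨Set.insert_subset hU hRQ, insert u S₁, ?_, ?_, ?_⟩
    · rw [Set.sUnion_insert]
      exact Set.insert_subset (Or.inl huU) (hS₁.trans Set.subset_union_right)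
    · rintro W (rfl | hW)
      · have hempty : ∀ s ∈ S₁, s ∉ W := by
          intro s hs hsU
          obtain ⟨W', hW', hsW'⟩ := hS₁ hs
          exact hUR (hdisj W' (hQ (hRQ hW')) W (hQ hU) s hsW' hsU ▸ hW')
        rintro s ⟨rfl | hs, hsU⟩ t ⟨rfl | ht, htU⟩
        · rfl
        · exact (hempty t ht htU).elim
        · exact (hempty s hs hsU).elim
        · exact (hempty s hs hsU).elim
      · rintro s ⟨rfl | hs, hsU⟩ t ⟨rfl | ht, htU⟩
        · rfl
        · exact (hdisjU W hW hsU).elim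
        · exact (hdisjU W hW htU).elim
        · exact hsub W hW ⟨hs, hsU⟩ ⟨ht, htU⟩
    · rintro W (rfl | hW)
      · exact hseed _ (hw.mono hmono) (.seed (Or.inr (Or.inl rfl)))
      · exact fun x hx => (hblue W hW x hx).mono hmono
  exact hUR (hmax hmem (Set.subset_insert _ _) (Set.mem_insert _ _))

theorem blue_of_connected (hconn : G.Connected) (hP : Setoid.IsPartition P) {T S : Set V}
    (hT : T ∈ P) (hTS : ∀ x ∈ T, G.Blue S x)
    (h : ∀ U ∈ P \ {T}, ∀ v ∈ U, ∀ w, G.Adj v w → G.Blue S w → ∀ x ∈ U, G.Blue S x) (v : V) :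
    G.Blue S v := by
  obtain ⟨t, ht⟩ := Setoid.nonempty_of_mem_partition hP hT
  refine hconn.mem_of_closed (T := {v | G.Blue S v}) (hTS t ht) (fun a b hab ha => ?_) v
  obtain ⟨U, ⟨hU, hbU⟩, -⟩ := hP.2 b
  by_cases hUT : U = T
  · exact hTS b (hUT ▸ hbU)
  · exact h U ⟨hU, hUT⟩ b hbU a hab.symm ha b hbU

theorem exists_blue_of_isDiamondSet [Finite V] (hconn : G.Connected) (hP : Setoid.IsPartition P)
    (hu : ∀ U ∈ P, G.IsUnitSet U) {T : Set V} (hT : T ∈ P) (hD : G.IsDiamondSet T) :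
    ∃ a, ∃ S : Set V, (∀ v, G.Blue (insert a S) v) ∧ ∀ U ∈ P, (S ∩ U).Subsingleton := by
  obtain ⟨a, b, c, d, h, rfl⟩ := hD
  obtain ⟨S₁, hS₁, hsub, hblue⟩ := exists_seeds hP hu (Q := P \ {{a, b, c, d}}) Set.sdiff_subset
    {a, c}
  -- The two starting seeds are an end `a` and a middle vertex `c`; only `c` counts as the seed of
  -- its unit, and `a` is the one extra vertex.
  refine ⟨a, insert c S₁, ?_, ?_⟩
  · have hins : insert a (insert c S₁) = {a, c} ∪ S₁ := by
      ext; simp [or_assoc]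
    rw [hins]
    refine blue_of_connected hconn hP hT ?_ hblue
    have ha : G.Blue ({a, c} ∪ S₁) a := .seed (by simp)
    have hc : G.Blue ({a, c} ∪ S₁) c := .seed (by simp)
    have hd := Blue.step h.ad.symm h.cd.symm h.ac.ne ha hc
    rintro x (rfl | rfl | rfl | rfl)
    exacts [ha, .step h.bc h.bd h.cd.ne hc hd, hc, hd]
  · intro U hU
    by_cases hUT : U = {a, b, c, d}
    · subst hUT
      have : ∀ s ∈ insert c S₁ ∩ {a, b, c, d}, s = c := by
        rintro s ⟨rfl | hs, hsU⟩
        · rfl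
        · obtain ⟨W, hW, hsW⟩ := hS₁ hs
          exact (hW.2 ((hP.2 s).unique ⟨hW.1, hsW⟩ ⟨hT, hsU⟩)).elim
      exact fun s hs t ht => (this s hs).trans (this t ht).symm
    · have hc : c ∉ U := fun hc => hUT ((hP.2 c).unique ⟨hU, hc⟩ ⟨hT, by simp⟩)
      rw [Set.insert_inter_of_notMem hc]
      exact hsub U ⟨hU, hUT⟩

/-! ### Bridges and starting from a triangle -/

/-- The set `C` is joined to its complement by the single edge from `x ∉ C` to `x' ∈ C`. -/
structure IsCut (G : SimpleGraph V) (x x' : V) (C : Set V) : Prop where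
  adj : G.Adj x x'
  notMem : x ∉ C
  mem : x' ∈ C
  closed : ∀ v ∈ C, ∀ w, G.Adj v w → w ∈ C ∨ v = x' ∧ w = x

theorem IsCubic.exists_blue_of_not_isCut [Finite V] (hG : G.IsCubic) (hconn : G.Connected)
    (hP : Setoid.IsPartition P) (hu : ∀ U ∈ P, G.IsUnitSet U) {x y z x' : V}
    (hT : {x, y, z} ∈ P) (hxy : G.Adj x y) (hxz : G.Adj x z) (hyz : G.Adj y z)
    (hxx' : G.Adj x x') (hx'y : x' ≠ y) (hx'z : x' ≠ z) (hcut : ¬ ∃ C, G.IsCut x x' C) :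
    ∃ S : Set V, (∀ v, G.Blue S v) ∧ ∀ U ∈ P, (S ∩ U).Subsingleton := by
  obtain ⟨S₁, hS₁, hsub, hblue⟩ := exists_seeds hP hu (Q := P \ {{x, y, z}}) Set.sdiff_subset {x}
  refine ⟨{x} ∪ S₁, ?_, ?_⟩
  · have hx : G.Blue ({x} ∪ S₁) x := .seed (by simp)
    have hout : ∀ v w, v ∉ ({x, y, z} : Set V) → G.Adj v w → G.Blue ({x} ∪ S₁) w →
        G.Blue ({x} ∪ S₁) v := by
      intro v w hv hvw hw
      obtain ⟨U, ⟨hU, hvU⟩, -⟩ := hP.2 v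
      exact hblue U ⟨hU, fun h => hv (h ▸ hvU)⟩ v hvU w hvw hw v hvU
    refine blue_of_connected hconn hP hT ?_ hblue
    suffices G.Blue ({x} ∪ S₁) y ∨ G.Blue ({x} ∪ S₁) z by
      rcases this with h | h
      · rintro w (rfl | rfl | rfl)
        exacts [hx, h, .step hxz.symm hyz.symm hxy.ne hx h]
      · rintro w (rfl | rfl | rfl)
        exacts [hx, .step hxy.symm hyz hxz.ne hx h, h]
    by_contra! hcon
    -- If `y` and `z` stay white, then no blue vertex other than `x` is adjacent to either of them,
    -- so the blue vertices other than `x` are joined to the rest only by the edge `xx'`.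
    refine hcut ⟨{v | G.Blue ({x} ∪ S₁) v ∧ v ≠ x}, hxx', fun h => h.2 rfl,
      ⟨hout x' x ?_ hxx'.symm hx, hxx'.ne'⟩, ?_⟩
    · simp [hx'y, hx'z, hxx'.ne']
    rintro v ⟨hv, hvx⟩ w hvw
    have hwy : w ≠ y := by
      rintro rfl
      exact hcon.1 (.step hxy.symm hvw.symm hvx.symm hx hv)
    have hwz : w ≠ z := by
      rintro rfl
      exact hcon.2 (.step hxz.symm hvw.symm hvx.symm hx hv)
    by_cases hwx : w = x
    · subst hwx
      rcases hG.eq_of_adj hxy hxz hxx' hyz.ne hx'y.symm hx'z.symm hvw.symm with rfl | rfl | rfl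
      exacts [(hcon.1 hv).elim, (hcon.2 hv).elim, Or.inr ⟨rfl, rfl⟩]
    · exact Or.inl ⟨hout w v (by simp [hwx, hwy, hwz]) hvw.symm hv, hwx⟩
  · intro U hU
    by_cases hUT : U = {x, y, z}
    · subst hUT
      have : ∀ s ∈ ({x} ∪ S₁) ∩ {x, y, z}, s = x := by
        rintro s ⟨rfl | hs, hsU⟩
        · rfl
        · obtain ⟨W, hW, hsW⟩ := hS₁ hs
          exact (hW.2 ((hP.2 s).unique ⟨hW.1, hsW⟩ ⟨hT, hsU⟩)).elim
      exact fun s hs t ht => (this s hs).trans (this t ht).symm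
    · have hx : x ∉ U := fun hx => hUT ((hP.2 x).unique ⟨hU, hx⟩ ⟨hT, by simp⟩)
      rw [Set.singleton_union, Set.insert_inter_of_notMem hx]
      exact hsub U ⟨hU, hUT⟩

/-- The edge of a cut does not lie in a triangle. -/
theorem IsCut.no_triangle {x x' t : V} {C : Set V} (h : G.IsCut x x' C) (h1 : G.Adj t x)
    (h2 : G.Adj t x') : False := by
  rcases h.closed x' h.mem t h2.symm with ht | ⟨-, rfl⟩
  · rcases h.closed t ht x h1 with hx | ⟨rfl, -⟩
    · exact h.notMem hx
    · exact h2.ne rfl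
  · exact h1.ne rfl

/-- Otherwise every edge leaving a triangle is a bridge. Given a bridge from `x` to `x' ∈ C`, the
unit of `x'` yields a bridge with a strictly smaller side: through a triangle one leaves by another
of its vertices, through a diamond by its other end. -/
theorem IsCubic.exists_not_isCut [Finite V] (hG : G.IsCubic) (hP : Setoid.IsPartition P)
    (hu : ∀ U ∈ P, G.IsUnitSet U) {T : Set V} (hT : T ∈ P) (hTri : G.IsTriangleSet T) :
    ∃ x y z x', {x, y, z} ∈ P ∧ G.Adj x y ∧ G.Adj x z ∧ G.Adj y z ∧ G.Adj x x' ∧ x' ≠ y ∧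
      x' ≠ z ∧ ¬ ∃ C, G.IsCut x x' C := by
  by_contra! H
  have key : ∀ n : ℕ, ∀ x x' (C : Set V), G.IsCut x x' C → C.ncard = n → False := by
    intro n
    induction n using Nat.strong_induction_on with
    | _ n ih =>
    rintro x x' C hC rfl
    have smaller : ∀ y y' D v, G.IsCut y y' D → D ⊆ C → v ∈ C → v ∉ D → False :=
      fun y y' D v hD hDC hvC hvD =>
        ih _ (Set.ncard_lt_ncard ⟨hDC, fun h => hvD (h hvC)⟩) y y' D hD rfl
    obtain ⟨U, ⟨hU, hxU⟩, -⟩ := hP.2 x'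
    rcases hu U hU with hU' | hU'
    · obtain ⟨q, r, hq, hr, hqr, rfl⟩ := hU'.exists_of_mem hxU
      have hxq : x ≠ q := by
        rintro rfl
        exact hC.no_triangle hqr.symm hr.symm
      have hqC : q ∈ C := (hC.closed x' hC.mem q hq).resolve_right fun h => hxq h.2.symm
      obtain ⟨q', hqq', hq'1, hq'2⟩ := hG.exists_third (v := q) x' r
      obtain ⟨D, hD⟩ := H q x' r q' (by rwa [Set.insert_comm]) hq.symm hqr hr hqq' hq'1 hq'2
      -- The side `D` beyond the bridge `qq'` cannot contain `x'`, so the edge `x'x` does not leave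
      -- `D` and `D ∩ C` is again cut off by `qq'` alone.
      have hx'D : x' ∉ D := fun h => by
        rcases hD.closed x' h q hq with h' | h'
        · exact hD.notMem h'
        · exact hq'1 h'.1.symm
      refine smaller q q' (D ∩ C) q ⟨hqq', fun h => hD.notMem h.1, ⟨hD.mem, ?_⟩, ?_⟩
        Set.inter_subset_right hqC fun h => hD.notMem h.1
      · exact (hC.closed q hqC q' hqq').resolve_right fun h => hq.ne h.1.symm
      · rintro v ⟨hvD, hvC⟩ w hvw
        rcases hD.closed v hvD w hvw with hwD | h
        · refine Or.inl ⟨hwD, (hC.closed v hvC w hvw).resolve_right fun h => ?_⟩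
          exact hx'D (h.1 ▸ hvD)
        · exact Or.inr h
    · rcases hU'.exists_of_mem hxU with ⟨b, c, d, h, rfl⟩ | ⟨a, b, d, h, rfl⟩
      · have hxc : x ≠ c := by
          rintro rfl
          exact hC.no_triangle h.cd.symm h.ad.symm
        have hxd : x ≠ d := by
          rintro rfl
          exact hC.no_triangle h.cd h.ac.symm
        have hcC : c ∈ C := (hC.closed x' hC.mem c h.ac).resolve_right fun h => hxc h.2.symm
        have hbC : b ∈ C := (hC.closed c hcC b h.bc.symm).resolve_right fun h' => h.ac.ne h'.1.symm
        obtain ⟨b', hbb', hb'c, hb'd⟩ := hG.exists_third (v := b) c d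
        have hb'C : b' ∈ C := (hC.closed b hbC b' hbb').resolve_right fun h' => h.ne h'.1.symm
        have hb'x' : b' ≠ x' := by
          rintro rfl
          exact h.not_adj hbb'.symm
        -- Only `x'` and `b` have neighbours outside the diamond, namely `x ∉ C` and `b'`; removing
        -- the diamond from `C` therefore leaves `bb'` as the only connecting edge.
        refine smaller b b' (C \ {x', b, c, d}) b ⟨hbb', by simp, ⟨hb'C, ?_⟩, ?_⟩
          Set.sdiff_subset hbC (by simp)
        · simp [hb'x', hbb'.ne', hb'c, hb'd]
        · rintro v ⟨hvC, hvU⟩ w hvw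
          simp only [Set.mem_insert_iff, Set.mem_singleton_iff, not_or] at hvU
          have hwC : w ∈ C := (hC.closed v hvC w hvw).resolve_right fun h => hvU.1 h.1
          by_cases hwU : w ∈ ({x', b, c, d} : Set V)
          · rcases hwU with rfl | rfl | rfl | rfl
            · have := hG.eq_of_adj h.ac h.ad hC.adj.symm h.cd.ne hxc.symm hxd.symm hvw.symm
              have := hC.notMem
              grind
            · have := hG.eq_of_adj h.bc h.bd hbb' h.cd.ne hb'c.symm hb'd.symm hvw.symm
              grind
            · have := hG.eq_of_adj h.ac.symm h.bc.symm h.cd h.ne h.ad.ne h.bd.ne hvw.symm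
              grind
            · have := hG.eq_of_adj h.ad.symm h.bd.symm h.cd.symm h.ne h.ac.ne h.bc.ne hvw.symm
              grind
          · exact Or.inl ⟨hwC, hwU⟩
      -- All edges at a middle vertex lie in triangles, so none of them is a bridge.
      · rcases hG.eq_of_adj h.ac.symm h.bc.symm h.cd h.ne h.ad.ne h.bd.ne hC.adj.symm with
          rfl | rfl | rfl
        · exact hC.no_triangle h.ad.symm h.cd.symm
        · exact hC.no_triangle h.bd.symm h.cd.symm
        · exact hC.no_triangle h.ad h.ac
  obtain ⟨x, y, z, hxy, hxz, hyz, rfl⟩ := hTri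
  obtain ⟨x', hxx', h1, h2⟩ := hG.exists_third (v := x) y z
  obtain ⟨C, hC⟩ := H x y z x' hT hxy hxz hyz hxx' h1 h2
  exact key _ x x' C hC rfl

/-! ### Lower bounds -/

theorem IsCubic.inter_nonempty_of_blue (hG : G.IsCubic) {S U : Set V} (hU : G.IsUnitSet U)
    (hS : ∀ v, G.Blue S v) : (S ∩ U).Nonempty := by
  by_contra hempty
  rw [Set.not_nonempty_iff_eq_empty, ← Set.disjoint_iff_inter_eq_empty] at hempty
  have hclosed : ∀ v, v ∈ Uᶜ := fun v => (hS v).mem_of_closed hempty.subset_compl_right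
    fun w a b ha hb hab haU hbU hw => hab (hG.eq_of_adj_of_notMem hU hw ha haU hb hbU)
  rcases hU with ⟨x, y, z, -, -, -, rfl⟩ | ⟨a, b, c, d, -, rfl⟩
  · exact hclosed x (by simp)
  · exact hclosed a (by simp)

theorem IsCubic.not_subsingleton_of_blue [Nonempty V] (hG : G.IsCubic)
    (hP : Setoid.IsPartition P) (hD : ∀ U ∈ P, G.IsDiamondSet U) {S : Set V}
    (hS : ∀ v, G.Blue S v) : ¬ ∀ U ∈ P, (S ∩ U).Subsingleton := by
  intro hsub
  have hnbr : ∀ U ∈ P, ∀ s ∈ S ∩ U, ∀ w, G.Adj s w → w ∈ U := by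
    intro U hU s hs w hsw
    rcases (hD U hU).exists_of_mem hs.2 with ⟨b, c, d, h, rfl⟩ | ⟨a, b, d, h, rfl⟩
    -- An end cannot be the only seed of its diamond: the triangle formed by the other three
    -- vertices must also contain a seed, although it is not a unit of the partition.
    · obtain ⟨t, htS, ht⟩ := hG.inter_nonempty_of_blue
        (Or.inl ⟨b, c, d, h.bc, h.bd, h.cd, rfl⟩) hS
      obtain rfl := hsub _ hU hs ⟨htS, Or.inr ht⟩
      rcases ht with ht | ht | ht
      exacts [(h.ne ht).elim, (h.ac.ne ht).elim, (h.ad.ne ht).elim]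
    · have := hG.eq_of_adj h.ac.symm h.bc.symm h.cd h.ne h.ad.ne h.bd.ne hsw
      grind
  -- Every neighbour of a seed lies in that seed's diamond, so two seeds with a common neighbour
  -- coincide. The rule never applies and `S` would have to be everything.
  have hall : ∀ v, v ∈ S := fun v => (hS v).mem_of_closed subset_rfl
    fun w a b ha hb hab haS hbS => by
      obtain ⟨U, ⟨hU, haU⟩, -⟩ := hP.2 a
      obtain ⟨W, ⟨hW, hbW⟩, -⟩ := hP.2 b
      have h1 := hnbr U hU a ⟨haS, haU⟩ w ha.symm
      have h2 := hnbr W hW b ⟨hbS, hbW⟩ w hb.symm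
      obtain rfl := (hP.2 w).unique ⟨hU, h1⟩ ⟨hW, h2⟩
      exact (hab (hsub U hU ⟨haS, haU⟩ ⟨hbS, hbW⟩)).elim
  obtain ⟨v⟩ := ‹Nonempty V›
  obtain ⟨U, ⟨hU, -⟩, -⟩ := hP.2 v
  obtain ⟨a, b, c, d, h, rfl⟩ := hD U hU
  exact h.ne (hsub _ hU ⟨hall a, by simp⟩ ⟨hall b, by simp⟩)

theorem ncard_le_of_subsingleton [Finite V] (hP : Setoid.IsPartition P) {S : Set V}
    (hS : ∀ U ∈ P, (S ∩ U).Subsingleton) : S.ncard ≤ P.ncard := by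
  choose f hf using fun v => (hP.2 v).exists
  exact Set.ncard_le_ncard_of_injOn f (fun v _ => (hf v).1)
    (fun v hv w hw hvw => hS (f v) (hf v).1 ⟨hv, (hf v).2⟩ ⟨hw, hvw ▸ (hf w).2⟩)

theorem ncard_le_of_nonempty [Finite V] (hP : Setoid.IsPartition P) {S : Set V}
    (hS : ∀ U ∈ P, (S ∩ U).Nonempty) :
    P.ncard ≤ S.ncard ∧ (S.ncard ≤ P.ncard → ∀ U ∈ P, (S ∩ U).Subsingleton) := by
  have hS' : ∀ U : P, (S ∩ U).Nonempty := fun U => hS U U.2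
  choose f hf using hS'
  have hinj : Function.Injective f := fun U W hUW =>
    Subtype.ext ((hP.2 (f U)).unique ⟨U.2, (hf U).2⟩ ⟨W.2, hUW ▸ (hf W).2⟩)
  have hsub : Set.range f ⊆ S := by
    rintro _ ⟨U, rfl⟩
    exact (hf U).1
  have hcard : (Set.range f).ncard = P.ncard := by
    rw [← Set.image_univ, Set.ncard_image_of_injective _ hinj, Set.ncard_univ]
    rfl
  refine ⟨hcard ▸ Set.ncard_le_ncard hsub, fun hle U hU => ?_⟩
  have heq := Set.eq_of_subset_of_ncard_le hsub (hle.trans hcard.ge)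
  have hval : ∀ s ∈ S ∩ U, s = f ⟨U, hU⟩ := by
    rintro s ⟨hs, hsU⟩
    rw [← heq] at hs
    obtain ⟨W, rfl⟩ := hs
    congr 1
    exact Subtype.ext ((hP.2 (f W)).unique ⟨W.2, (hf W).2⟩ ⟨hU, hsU⟩)
  exact fun s hs t ht => (hval s hs).trans (hval t ht).symm

end Seeds

/-! ### Diamond-necklaces -/

theorem diamondNecklace_adj {k : ℕ} {x y : ZMod k × Fin 4} :
    (diamondNecklace k).Adj x y ↔ x ≠ y ∧
      ((x.1 = y.1 ∧ diamondGraph.Adj x.2 y.2 ∨ x.2 = 0 ∧ y.2 = 1 ∧ y.1 = x.1 + 1) ∨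
        y.1 = x.1 ∧ diamondGraph.Adj y.2 x.2 ∨ y.2 = 0 ∧ x.2 = 1 ∧ x.1 = y.1 + 1) :=
  fromRel_adj _ _ _

theorem isDiamond_diamondNecklace {k : ℕ} (hk : 2 ≤ k) (i : ZMod k) :
    (diamondNecklace k).IsDiamond (i, 0) (i, 1) (i, 2) (i, 3) := by
  have : Fact (1 < k) := ⟨hk⟩
  constructor <;> simp [diamondNecklace_adj, diamondGraph]

/-- Each vertex of a necklace lies in a diamond, and a triangle-closed set meeting a diamond
contains its four vertices, too many for a triangle. -/
theorem IsDiamondNecklace.not_isTriangleSet {G : SimpleGraph V} (h : G.IsDiamondNecklace)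
    {U : Set V} (hU : G.TriangleClosed U) : ¬ G.IsTriangleSet U := by
  obtain ⟨k, hk, ⟨e⟩⟩ := h
  rintro ⟨x, y, z, -, -, -, rfl⟩
  have hN := isDiamond_diamondNecklace hk (e x).1
  have hD : G.IsDiamond (e.symm ((e x).1, 0)) (e.symm ((e x).1, 1)) (e.symm ((e x).1, 2))
      (e.symm ((e x).1, 3)) :=
    ⟨e.symm.map_adj_iff.2 hN.ac, e.symm.map_adj_iff.2 hN.ad, e.symm.map_adj_iff.2 hN.bc,
      e.symm.map_adj_iff.2 hN.bd, e.symm.map_adj_iff.2 hN.cd, e.symm.injective.ne hN.ne,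
      fun h => hN.not_adj (e.symm.map_adj_iff.1 h)⟩
  have hx : x ∈ ({e.symm ((e x).1, 0), e.symm ((e x).1, 1), e.symm ((e x).1, 2),
      e.symm ((e x).1, 3)} : Set V) := by
    have hx' : ∀ s : Fin 4, (e x).2 = s → x = e.symm ((e x).1, s) := by
      rintro s rfl
      simp
    have hs : ∀ s : Fin 4, s = 0 ∨ s = 1 ∨ s = 2 ∨ s = 3 := by decide
    rcases hs (e x).2 with h | h | h | h
    exacts [Or.inl (hx' _ h), Or.inr (Or.inl (hx' _ h)), Or.inr (Or.inr (Or.inl (hx' _ h))),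
      Or.inr (Or.inr (Or.inr (hx' _ h)))]
  have hsub := IsUnitSet.subset_of_triangleClosed (Or.inr ⟨_, _, _, _, hD, rfl⟩) hU hx (by simp)
  have h0 := hsub (Or.inl rfl)
  have h1 := hsub (Or.inr (Or.inl rfl))
  have h2 := hsub (Or.inr (Or.inr (Or.inl rfl)))
  have h3 := hsub (Or.inr (Or.inr (Or.inr rfl)))
  have := hD.ac.ne
  have := hD.ad.ne
  have := hD.bc.ne
  have := hD.bd.ne
  have := hD.cd.ne
  have := hD.ne
  simp only [Set.mem_insert_iff, Set.mem_singleton_iff] at h0 h1 h2 h3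
  grind

/-! ### Cubic graphs composed of diamonds -/

section Diamonds

variable {G : SimpleGraph V}

/-- The degree-three vertex of a diamond is not the end of a diamond. -/
theorem IsDiamond.mid_ne_end (hG : G.IsCubic) {a b c d b' c' d' : V} (h : G.IsDiamond a b c d)
    (h' : G.IsDiamond c b' c' d') : False := by
  have h1 := hG.eq_of_adj h.ac.symm h.bc.symm h.cd h.ne h.ad.ne h.bd.ne h'.ac
  have h2 := hG.eq_of_adj h.ac.symm h.bc.symm h.cd h.ne h.ad.ne h.bd.ne h'.ad
  have h3 : G.Adj d b' := by
    have := h'.cd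
    have := h'.cd.symm
    have := h'.bc.symm
    have := h'.bd.symm
    have := h.not_adj
    have := h'.cd.ne
    grind
  have := h.ac.symm
  have := h.bc.symm
  have := h'.not_adj
  have := h'.ne
  rcases hG.eq_of_adj h.ad.symm h.bd.symm h.cd.symm h.ne h.ac.ne h.bc.ne h3 with rfl | rfl | rfl
  · contradiction
  · contradiction
  · contradiction

theorem IsDiamond.end_unique (hG : G.IsCubic) {a b c d b' c' d' : V} (h : G.IsDiamond a b c d)
    (h' : G.IsDiamond b b' c' d') : b' = a := by
  obtain ⟨n, hn, hnc, hnd⟩ := hG.exists_third (v := b) c d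
  have h1 := hG.eq_of_adj h.bc h.bd hn h.cd.ne hnc.symm hnd.symm h'.ac
  have h2 := hG.eq_of_adj h.bc h.bd hn h.cd.ne hnc.symm hnd.symm h'.ad
  have := h'.cd.ne
  have h3 : G.Adj c b' ∨ G.Adj d b' := by
    have := h'.bc.symm
    have := h'.bd.symm
    grind
  have := h'.not_adj
  have := h'.ne
  have := h.bc
  have := h.bd
  rcases h3 with h3 | h3
  · have := hG.eq_of_adj h.ac.symm h.bc.symm h.cd h.ne h.ad.ne h.bd.ne h3
    grind
  · have := hG.eq_of_adj h.ad.symm h.bd.symm h.cd.symm h.ne h.ac.ne h.bc.ne h3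
    grind

/-- The edge leaving a diamond does not lie in a triangle. -/
theorem IsDiamond.no_triangle (hG : G.IsCubic) {a b c d n t : V} (h : G.IsDiamond a b c d)
    (hn : G.Adj a n) (hnc : n ≠ c) (hnd : n ≠ d) (ht : G.Adj t a) (htn : G.Adj t n) : False := by
  have := h.not_adj
  rcases hG.eq_of_adj h.ac h.ad hn h.cd.ne hnc.symm hnd.symm ht.symm with rfl | rfl | rfl
  · have := hG.eq_of_adj h.ac.symm h.bc.symm h.cd h.ne h.ad.ne h.bd.ne htn
    have := hn.ne
    grind
  · have := hG.eq_of_adj h.ad.symm h.bd.symm h.cd.symm h.ne h.ac.ne h.bc.ne htn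
    have := hn.ne
    grind
  · exact htn.ne rfl

/-- Two fixed-point free involutions generate a dihedral group: the orbit of `x` under `β ∘ ν`
does not meet its image under `β`. -/
theorem involutive_comp_iterate_ne {E : Type*} {β ν : E → E} (hβ : Function.Involutive β)
    (hν : Function.Involutive ν) (hβ' : ∀ x, β x ≠ x) (hν' : ∀ x, ν x ≠ x) (x : E) (i j : ℕ) :
    β ((β ∘ ν)^[i] x) ≠ (β ∘ ν)^[j] x := by
  have hinj : Function.Injective (β ∘ ν) := hβ.injective.comp hν.injective
  have hrev : ∀ n : ℕ, (β ∘ ν)^[n] (β ((β ∘ ν)^[n] x)) = β x := by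
    intro n
    induction n with
    | zero => rfl
    | succ n ih =>
      rw [Function.iterate_succ_apply, Function.iterate_succ_apply']
      simp only [Function.comp_apply, hβ _, hν _]
      exact ih
  intro h
  have h1 : β x = (β ∘ ν)^[i + j] x := by
    rw [← hrev i, h, Function.iterate_add_apply]
  -- With `y = (β ∘ ν)^[n] x`, `hrev` turns the even case into `β y = y` and the odd case into `ν y
  -- = y`.
  obtain ⟨n, hn | hn⟩ := Nat.even_or_odd' (i + j)
  · rw [hn, two_mul, Function.iterate_add_apply, ← hrev n] at h1
    exact hβ' _ (hinj.iterate n h1)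
  · rw [hn, two_mul, add_assoc, Function.iterate_add_apply, ← hrev n,
      Function.iterate_succ_apply'] at h1
    exact hν' _ (hβ.injective (hinj.iterate n h1)).symm

theorem IsCubic.isDiamondNecklace [Finite V] (hG : G.IsCubic) (hconn : G.Connected)
    (hK : IsEmpty (G ≃g completeGraph (Fin 4)))
    (hD : ∀ v, ∃ U, v ∈ U ∧ G.IsDiamondSet U) : G.IsDiamondNecklace := by
  let E := {v : V // ∃ b c d, G.IsDiamond v b c d}
  have hE : ∀ a : E, ∃ (b : E) (c d : V) (n : E), G.IsDiamond a b c d ∧ G.Adj a n ∧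
      (n : V) ≠ c ∧ (n : V) ≠ d := by
    rintro ⟨a, b, c, d, h⟩
    obtain ⟨n, hn, hnc, hnd⟩ := hG.exists_third (v := a) c d
    refine ⟨⟨b, a, c, d, h.swap_ends⟩, c, d, ⟨n, ?_⟩, h, hn, hnc, hnd⟩
    obtain ⟨U, hnU, hU⟩ := hD n
    rcases hU.exists_of_mem hnU with ⟨p, q, r, h', -⟩ | ⟨p, q, r, h', -⟩
    · exact ⟨p, q, r, h'⟩
    · exfalso
      rcases hG.eq_of_adj h'.ac.symm h'.bc.symm h'.cd h'.ne h'.ad.ne h'.bd.ne hn.symm with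
        rfl | rfl | rfl
      · exact h.no_triangle hG hn hnc hnd h'.ad.symm h'.cd.symm
      · exact h.no_triangle hG hn hnc hnd h'.bd.symm h'.cd.symm
      · exact h.no_triangle hG hn hnc hnd h'.ad h'.ac
  -- On diamond ends, `β` is the opposite end, `γ` and `δ` are the middle vertices, and `ν` is the
  -- neighbour outside the diamond, which is again an end.
  choose β γ δ ν hdia hadj hνγ hνδ using hE
  have hβ : Function.Involutive β := fun a => Subtype.ext ((hdia a).end_unique hG (hdia (β a)))
  have hν : Function.Involutive ν := by
    intro a
    have ht : ∀ t, G.Adj t a → G.Adj t (ν a) → False := fun t =>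
      (hdia a).no_triangle hG (hadj a) (hνγ a) (hνδ a)
    have h := hdia (ν a)
    rcases hG.eq_of_adj h.ac h.ad (hadj (ν a)) h.cd.ne (hνγ _).symm (hνδ _).symm
      (hadj a).symm with h1 | h1 | h1
    · exact (ht _ (h1 ▸ h.cd.symm) h.ad.symm).elim
    · exact (ht _ (h1 ▸ h.cd) h.ac.symm).elim
    · exact Subtype.ext h1.symm
  have hβ' : ∀ a, β a ≠ a := fun a h => (hdia a).ne (congrArg Subtype.val h).symm
  have hν' : ∀ a, ν a ≠ a := fun a h => (hadj a).ne (congrArg Subtype.val h).symm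
  have hclosed : ∀ a : E, G.IsUnitSet {(a : V), (β a : V), γ a, δ a} ∧
      G.TriangleClosed {(a : V), (β a : V), γ a, δ a} := fun a =>
    have h := hdia a
    hG.isUnitSet_of_common_neighbour hconn hK h.cd h.ac.symm h.ad.symm h.bc h.bd h.ne.symm
  have hmeet : ∀ (a a' : E) (v : V), v ∈ ({(a : V), (β a : V), γ a, δ a} : Set V) →
      v ∈ ({(a' : V), (β a' : V), γ a', δ a'} : Set V) → a' = a ∨ a' = β a := by
    intro a a' v hv hv'
    have h := (hclosed a).1.eq_of_mem (hclosed a).2 (hclosed a').1 (hclosed a').2 hv hv'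
    have ha' : (a' : V) ∈ ({(a : V), (β a : V), γ a, δ a} : Set V) := h ▸ Set.mem_insert _ _
    rcases ha' with h1 | h1 | h1 | h1
    · exact Or.inl (Subtype.ext h1)
    · exact Or.inr (Subtype.ext h1)
    · have := hdia a'
      rw [h1] at this
      exact ((hdia a).mid_ne_end hG this).elim
    · have := hdia a'
      rw [Set.mem_singleton_iff.1 h1] at this
      exact ((hdia a).swap_mid.mid_ne_end hG this).elim
  have hinj : Function.Injective (β ∘ ν) := hβ.injective.comp hν.injective
  obtain ⟨v₀⟩ := hconn.nonempty
  obtain ⟨U, -, p, q, r, s, hp, -⟩ := hD v₀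
  let a₀ : E := ⟨p, q, r, s, hp⟩
  let k := Function.minimalPeriod (β ∘ ν) a₀
  have hk0 : 0 < k :=
    Function.minimalPeriod_pos_of_mem_periodicPts (hinj.mem_periodicPts a₀)
  -- Period one would make the two ends of a diamond adjacent.
  have hk1 : k ≠ 1 := by
    intro h
    have h' : β (ν a₀) = a₀ := Function.minimalPeriod_eq_one_iff_isFixedPt.1 h
    have h'' : ν a₀ = β a₀ := by rw [← h', hβ, h']
    exact (hdia a₀).not_adj (h'' ▸ hadj a₀)
  have : NeZero k := ⟨hk0.ne'⟩
  let α : ZMod k → E := fun i => (β ∘ ν)^[i.val] a₀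
  have hα : ∀ i, α (i + 1) = β (ν (α i)) := by
    intro i
    have h1 : (i + 1).val = (i.val + 1) % k := by
      rw [ZMod.val_add, ZMod.val_one_eq_one_mod, Nat.add_mod_mod]
    change (β ∘ ν)^[(i + 1).val] a₀ = (β ∘ ν) ((β ∘ ν)^[i.val] a₀)
    rw [h1, Function.iterate_mod_minimalPeriod_eq, Function.iterate_succ_apply']
  have hαinj : Function.Injective α := fun i j hij =>
    ZMod.val_injective k (Function.iterate_injOn_Iio_minimalPeriod (ZMod.val_lt i) (ZMod.val_lt j)
      hij)
  -- Without this the walk could return to a diamond through its other end, and `φ` would not be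
  -- injective.
  have hαβ : ∀ i j, β (α i) ≠ α j := fun i j =>
    involutive_comp_iterate_ne hβ hν hβ' hν' a₀ _ _
  have hnext : ∀ i, G.Adj (α i) (β (α (i + 1))) := by
    intro i
    rw [hα, hβ]
    exact hadj _
  let φ : ZMod k × Fin 4 → V := fun x =>
    ![(α x.1 : V), (β (α x.1) : V), γ (α x.1), δ (α x.1)] x.2
  have hφmem : ∀ x, φ x ∈ ({(α x.1 : V), (β (α x.1) : V), γ (α x.1), δ (α x.1)} : Set V) := by
    rintro ⟨i, s⟩
    fin_cases s <;> simp [φ]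
  have hφ : Function.Injective φ := by
    rintro ⟨i, s⟩ ⟨j, t⟩ h
    have hij : i = j := by
      rcases hmeet (α i) (α j) (φ (i, s)) (hφmem _) (h ▸ hφmem (j, t)) with h' | h'
      · exact hαinj h'.symm
      · exact (hαβ i j h'.symm).elim
    subst hij
    exact congrArg _ ((hdia (α i)).injective h)
  have hnbr : ∀ x v, G.Adj (φ x) v ↔ ∃ y, (diamondNecklace k).Adj x y ∧ v = φ y := by
    rintro ⟨i, s⟩ v
    have h0 := hdia (α i)
    constructor
    · intro h
      fin_cases s
      · have hne : ∀ t, φ (i + 1, 1) = φ (i, t) → 1 = t := fun t ht =>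
          congrArg Prod.snd (hφ ht)
        rcases hG.eq_of_adj h0.ac h0.ad (hnext i) h0.cd.ne (fun h => by simpa using hne 2 h.symm)
          (fun h => by simpa using hne 3 h.symm) h with rfl | rfl | rfl
        · exact ⟨(i, 2), by simp [diamondNecklace_adj, diamondGraph], rfl⟩
        · exact ⟨(i, 3), by simp [diamondNecklace_adj, diamondGraph], rfl⟩
        · exact ⟨(i + 1, 1), by simp [diamondNecklace_adj, diamondGraph], rfl⟩
      · have hne : ∀ t, φ (i - 1, 0) = φ (i, t) → 0 = t := fun t ht =>
          congrArg Prod.snd (hφ ht)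
        have hprev := hnext (i - 1)
        rw [sub_add_cancel] at hprev
        rcases hG.eq_of_adj h0.bc h0.bd hprev.symm h0.cd.ne
          (fun h => by simpa using hne 2 h.symm)
          (fun h => by simpa using hne 3 h.symm) h with rfl | rfl | rfl
        · exact ⟨(i, 2), by simp [diamondNecklace_adj, diamondGraph], rfl⟩
        · exact ⟨(i, 3), by simp [diamondNecklace_adj, diamondGraph], rfl⟩
        · exact ⟨(i - 1, 0), by simp [diamondNecklace_adj, diamondGraph], rfl⟩
      · rcases hG.eq_of_adj h0.ac.symm h0.bc.symm h0.cd h0.ne h0.ad.ne h0.bd.ne h with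
          rfl | rfl | rfl
        · exact ⟨(i, 0), by simp [diamondNecklace_adj, diamondGraph], rfl⟩
        · exact ⟨(i, 1), by simp [diamondNecklace_adj, diamondGraph], rfl⟩
        · exact ⟨(i, 3), by simp [diamondNecklace_adj, diamondGraph], rfl⟩
      · rcases hG.eq_of_adj h0.ad.symm h0.bd.symm h0.cd.symm h0.ne h0.ac.ne h0.bc.ne h with
          rfl | rfl | rfl
        · exact ⟨(i, 0), by simp [diamondNecklace_adj, diamondGraph], rfl⟩
        · exact ⟨(i, 1), by simp [diamondNecklace_adj, diamondGraph], rfl⟩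
        · exact ⟨(i, 2), by simp [diamondNecklace_adj, diamondGraph], rfl⟩
    · rintro ⟨⟨j, t⟩, h, rfl⟩
      have hdiag : ∀ i s t, diamondGraph.Adj s t → G.Adj (φ (i, s)) (φ (i, t)) := fun i s t =>
        ((hdia (α i)).adj_iff s t).2
      rcases (diamondNecklace_adj.1 h).2 with
        (⟨h1, h2⟩ | ⟨h1, h2, h3⟩) | ⟨h1, h2⟩ | ⟨h1, h2, h3⟩ <;> dsimp only at h1 h2
      · exact h1 ▸ hdiag i s t h2
      · subst h1 h2 h3
        exact hnext i
      · exact h1 ▸ hdiag i s t h2.symm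
      · subst h1 h2 h3
        exact (hnext j).symm
  have hsurj : Function.Surjective φ := by
    refine hconn.mem_of_closed (T := Set.range φ) (v := φ 0) ⟨0, rfl⟩ ?_
    rintro _ b hab ⟨x, rfl⟩
    obtain ⟨y, -, rfl⟩ := (hnbr x b).1 hab
    exact ⟨y, rfl⟩
  refine ⟨k, by omega, ⟨RelIso.symm ⟨Equiv.ofBijective φ ⟨hφ, hsurj⟩, ?_⟩⟩⟩
  intro x y
  change G.Adj (φ x) (φ y) ↔ _
  rw [hnbr]
  constructor
  · rintro ⟨z, hz, h⟩
    exact hφ h ▸ hz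
  · exact fun h => ⟨y, h, rfl⟩

end Diamonds

end SimpleGraph

/-! ### Assembly of the bounds -/

theorem mainTheorem2 {V : Type*} [Fintype V] (G : SimpleGraph V) [DecidableRel G.Adj]
    (hcubic : G.IsRegularOfDegree 3) :
    (∀ S : Set V, G.IsSpreadingSet 2 3 S ↔ G.IsPercolatingSet 2 S) ∧
    (G.Connected → G.IsClawFree → IsEmpty (G ≃g SimpleGraph.completeGraph (Fin 4)) →
      (∃! P : Set (Set V), G.IsTriangleDiamondPartition P) ∧
      (G.IsDiamondNecklace → G.spreadingNumber 2 3 = G.numUnits + 1) ∧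
      (¬ G.IsDiamondNecklace → G.spreadingNumber 2 3 = G.numUnits)) := by
  classical
  have hG := hcubic.isCubic
  refine ⟨hG.isSpreadingSet_iff, fun hconn hcf hK => ?_⟩
  obtain ⟨P, hPart⟩ := hG.exists_partition hconn hcf hK
  have hunique : ∀ P', G.IsTriangleDiamondPartition P' → P' = P := fun P' hP' =>
    hG.partition_unique hP' hPart
  have hnum : G.numUnits = P.ncard := by
    have : {n | ∃ P' : Set (Set V), G.IsTriangleDiamondPartition P' ∧ P'.ncard = n} =
        {P.ncard} := by
      ext n
      constructor
      · rintro ⟨P', hP', rfl⟩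
        rw [hunique P' hP', Set.mem_singleton_iff]
      · rintro rfl
        exact ⟨P, hPart, rfl⟩
    rw [SimpleGraph.numUnits, this, csInf_singleton]
  have hspread : ∀ n : ℕ, (∃ S : Set V, (∀ v, G.Blue S v) ∧ S.ncard ≤ n) →
      (∀ S : Set V, (∀ v, G.Blue S v) → n ≤ S.ncard) → G.spreadingNumber 2 3 = n := by
    rintro n ⟨S, hS, hSn⟩ hlow
    have hmem : S.ncard ∈ {n | ∃ S : Finset V, G.IsSpreadingSet 2 3 (S : Set V) ∧ S.card = n} := by
      refine ⟨S.toFinset, ?_, (Set.ncard_eq_toFinset_card' S).symm⟩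
      rw [Set.coe_toFinset, hG.isSpreadingSet_iff, SimpleGraph.isPercolatingSet_two_iff]
      exact hS
    refine le_antisymm ((Nat.sInf_le hmem).trans hSn) (le_csInf ⟨_, hmem⟩ ?_)
    rintro _ ⟨S, hS, rfl⟩
    rw [hG.isSpreadingSet_iff, SimpleGraph.isPercolatingSet_two_iff] at hS
    simpa using hlow S hS
  refine ⟨⟨P, hPart, hunique⟩, ?_⟩
  obtain ⟨hP, hu⟩ := SimpleGraph.isTriangleDiamondPartition_iff.1 hPart
  rw [hnum]
  have hlow : ∀ S : Set V, (∀ v, G.Blue S v) → ∀ U ∈ P, (S ∩ U).Nonempty := fun S hS U hU =>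
    hG.inter_nonempty_of_blue (hu U hU) hS
  have : Nonempty V := hconn.nonempty
  constructor
  · intro hneck
    have hD : ∀ U ∈ P, G.IsDiamondSet U := fun U hU => (hu U hU).resolve_left
      (hneck.not_isTriangleSet (hG.triangleClosed_of_mem hP hu hU))
    refine hspread _ ?_ fun S hS => ?_
    · obtain ⟨v⟩ := ‹Nonempty V›
      obtain ⟨U, ⟨hU, -⟩, -⟩ := hP.2 v
      obtain ⟨a, S, hS, hsub⟩ := SimpleGraph.exists_blue_of_isDiamondSet hconn hP hu hU (hD U hU)
      exact ⟨_, hS, (Set.ncard_insert_le a S).trans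
        (Nat.succ_le_succ (SimpleGraph.ncard_le_of_subsingleton hP hsub))⟩
    · by_contra! hlt
      exact hG.not_subsingleton_of_blue hP hD hS
        -- With at most as many seeds as units and at least one in each, every unit has exactly one.
        ((SimpleGraph.ncard_le_of_nonempty hP (hlow S hS)).2 (Nat.lt_succ_iff.1 hlt))
  · intro hneck
    have hT : ∃ T ∈ P, G.IsTriangleSet T := by
      by_contra! hT
      refine hneck (hG.isDiamondNecklace hconn hK fun v => ?_)
      obtain ⟨U, ⟨hU, hvU⟩, -⟩ := hP.2 v
      exact ⟨U, hvU, (hu U hU).resolve_left (hT U hU)⟩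
    obtain ⟨T, hTP, hT⟩ := hT
    obtain ⟨x, y, z, x', hxyz, hxy, hxz, hyz, hxx', h1, h2, hcut⟩ :=
      hG.exists_not_isCut hP hu hTP hT
    obtain ⟨S, hS, hsub⟩ :=
      hG.exists_blue_of_not_isCut hconn hP hu hxyz hxy hxz hyz hxx' h1 h2 hcut
    exact hspread _ ⟨S, hS, SimpleGraph.ncard_le_of_subsingleton hP hsub⟩ fun S hS =>
      (SimpleGraph.ncard_le_of_nonempty hP (hlow S hS)).1
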